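/- Let $c_1,c_2,\lambda>0$. Let $\{N(t)\}_{t\ge 0}$ be a homogeneous Poisson process with rate $\lambda$, and let $V(0)$ be a random variable, independent of $N$, with $P\{V(0)=c_1\}=P\{V(0)=-c_2\}=\tfrac12$. Let the velocity $V(s)$ start at $V(0)$ and switch between $c_1$ and $-c_2$ at each event of $N$, and let $\mathcal T(s)=\int_0^s V(u)\,du$ be the asymmetric telegraph process. Then for every $t>0$, every integer $k\ge 0$ and every $\beta\in[0,c_1t]$, the event $\{V(0)=-c_2,\ N(t)=2k\}$ has positive probability, $\mathcal T$ almost surely attains a maximum on $[0,t]$, and $$P\Bigl\{\max_{0\le s\le t}\mathcal T(s)\le\beta\ \Big|\ V(0)=-c_2,\ N(t)=2k\Bigr\}=\sum_{j=0}^{k}\binom{2k}{j}\frac{(c_1t-\beta)^j(c_2t+\beta)^{2k-j}}{[(c_1+c_2)t]^{2k}}-\sum_{j=0}^{k-1}\binom{2k}{j}\Bigl(\frac{c_2}{c_1}\Bigr)^{2k-1-2j}\frac{(c_1t-\beta)^{2k-j}(c_2t+\beta)^j}{[(c_1+c_2)t]^{2k}},$$ where the second sum is empty for $k=0$. -/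

import Mathlib

open MeasureTheory ProbabilityTheory Set
open scoped NNReal

/-- The `n`-th arrival time `τ₀ + … + τₙ₋₁` associated with the waiting times `τ`
(arrivals are numbered `1, 2, …`, and time `0` is arrival number `0`). -/
def arrivalTime {Ω : Type*} (τ : ℕ → Ω → ℝ) (n : ℕ) (ω : Ω) : ℝ :=
  ∑ i ∈ Finset.range n, τ i ω

/-- `N` is a homogeneous Poisson process of rate `lam`: it counts the arrivals up to time `t`
for i.i.d. exponential waiting times of parameter `lam`.  The equality in `ℕ∞` also says that
almost surely there are only finitely many arrivals in bounded time. -/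
structure IsPoissonProcess {Ω : Type*} [MeasurableSpace Ω] (N : ℝ≥0 → Ω → ℕ) (lam : ℝ)
    (μ : Measure Ω) : Prop where
  measurable : ∀ t, Measurable (N t)
  exists_waitingTimes : ∃ τ : ℕ → Ω → ℝ,
    (∀ n, Measurable (τ n)) ∧ (∀ n, HasLaw (τ n) (expMeasure lam) μ) ∧ iIndepFun τ μ ∧
    ∀ᵐ ω ∂μ, ∀ t : ℝ≥0, (N t ω : ℕ∞) = {n : ℕ | arrivalTime τ (n + 1) ω ≤ t}.encard

/-- The random data driving an asymmetric telegraph process with velocities `c₁` and `-c₂`: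
an initial velocity `V₀` equal to `c₁` or `-c₂` with probability `1/2` each, and an independent
Poisson process `N` of rate `lam`, which counts the velocity reversals. -/
structure IsTelegraphData {Ω : Type*} [MeasurableSpace Ω] (c₁ c₂ lam : ℝ)
    (V₀ : Ω → ℝ) (N : ℝ≥0 → Ω → ℕ) (μ : Measure Ω) : Prop where
  measurable_init : Measurable V₀
  init_right : μ {ω | V₀ ω = c₁} = 1 / 2
  init_left : μ {ω | V₀ ω = -c₂} = 1 / 2
  poisson : IsPoissonProcess N lam μ
  indep : IndepFun V₀ (fun ω t => N t ω) μ

/-- The velocity `V(s)`: it starts at `V₀` and is switched between `c₁` and `-c₂`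
at each arrival of `N`; the map `v ↦ c₁ - c₂ - v` exchanges `c₁` and `-c₂`. -/
noncomputable def telegraphVelocity {Ω : Type*} (c₁ c₂ : ℝ) (V₀ : Ω → ℝ) (N : ℝ≥0 → Ω → ℕ)
    (s : ℝ≥0) (ω : Ω) : ℝ :=
  if Even (N s ω) then V₀ ω else c₁ - c₂ - V₀ ω

/-- The position of the particle: `𝒯(s) = ∫₀ˢ V(u) du`. -/
noncomputable def telegraphProcess {Ω : Type*} (c₁ c₂ : ℝ) (V₀ : Ω → ℝ) (N : ℝ≥0 → Ω → ℕ)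
    (s : ℝ≥0) (ω : Ω) : ℝ :=
  ∫ u in (0 : ℝ)..(s : ℝ), telegraphVelocity c₁ c₂ V₀ N u.toNNReal ω

/-- The running maximum of a real process over `[0, t]`. -/
noncomputable def runningMax {Ω : Type*} (X : ℝ≥0 → Ω → ℝ) (t : ℝ≥0) (ω : Ω) : ℝ :=
  sSup ((fun s => X s ω) '' Icc 0 t)

/-! Condition on the first reversal. Write `p = c₁ s - b` and `q = c₂ s + b` for horizon `s` and
barrier `b`. A leftward leg of duration `u` replaces `(s, b)` by `(s - u, b + c₂ u)`: it fixes `q`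
and lowers `p` by `(c₁ + c₂) u`. A rightward leg fixes `q`'s partner `p` and lowers `q` by the same
amount. With exponential waiting times the factors `exp (-lam u)` and `exp (-lam (s - u))` combine
to a constant, so only volumes of waiting-time configurations remain, and they satisfy `∂_q odd_k =
even_k`, `∂_p even_{k+1} = odd_k`.

Two boundary conditions fix the solution. On `p = 0` the barrier cannot be exceeded and the volume
is that of a full simplex; on `q = r p`, that is `b = 0`, a rightward start violates the barrier at
once and the odd volume vanishes. The subtracted sums, with their powers of `r = c₂ / c₁`, enforce
the second condition.

`integral_leftWeight` and `integral_rightWeight` integrate the recursion, and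
`IsExpSequence.real_confinedPath_left` turns it into probabilities by induction.
`IsCountingPath.confinedPath_iff` reduces the running maximum to the reversal times, and
`indepFun_waitingTimes` separates the initial velocity. Dividing by the same formula at `b = c₁ t`
gives the conditional law. -/

/-! ### Divided powers and volume polynomials -/

/-- The divided power `x ^ n / n!`. -/
noncomputable def dividedPow (n : ℕ) (x : ℝ) : ℝ := x ^ n / (n.factorial : ℝ)

lemma dividedPow_zero_left (x : ℝ) : dividedPow 0 x = 1 := by simp [dividedPow]

lemma dividedPow_zero_right {n : ℕ} (hn : n ≠ 0) : dividedPow n 0 = 0 := by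
  simp [dividedPow, hn]

lemma dividedPow_mul (n : ℕ) (a x : ℝ) : dividedPow n (a * x) = a ^ n * dividedPow n x := by
  simp only [dividedPow, mul_pow]; ring

lemma hasDerivAt_dividedPow_succ (n : ℕ) (x : ℝ) :
    HasDerivAt (dividedPow (n + 1)) (dividedPow n x) x := by
  have h := (hasDerivAt_pow (n + 1) x).div_const ((n + 1).factorial : ℝ)
  refine h.congr_deriv ?_
  have h1 : (n.factorial : ℝ) ≠ 0 := by positivity
  have h2 : (n : ℝ) + 1 ≠ 0 := by positivity
  simp only [dividedPow, Nat.factorial_succ, Nat.add_sub_cancel]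
  push_cast
  field_simp

lemma continuous_dividedPow (n : ℕ) : Continuous (dividedPow n) := by
  unfold dividedPow; fun_prop

/-- Volume of the configurations of `2k` reversals of a path that starts leftwards and stays below
a barrier, in the coordinates `p = c₁ s - b`, `q = c₂ s + b` (time scaled by `c₁ + c₂`,
`r = c₂ / c₁`). -/
noncomputable def evenVolume (r : ℝ) (k : ℕ) (p q : ℝ) : ℝ :=
  ∑ j ∈ Finset.range (k + 1), dividedPow j p * dividedPow (2 * k - j) q -
    ∑ j ∈ Finset.range k, r ^ (2 * k - 1 - 2 * j) * (dividedPow (2 * k - j) p * dividedPow j q)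

/-- The analogue of `evenVolume` for `2k + 1` reversals of a path that starts rightwards. -/
noncomputable def oddVolume (r : ℝ) (k : ℕ) (p q : ℝ) : ℝ :=
  ∑ j ∈ Finset.range (k + 1), dividedPow j p * dividedPow (2 * k + 1 - j) q -
    ∑ j ∈ Finset.range (k + 1),
      r ^ (2 * k + 1 - 2 * j) * (dividedPow (2 * k + 1 - j) p * dividedPow j q)

lemma continuous_evenVolume (r : ℝ) (k : ℕ) :
    Continuous fun x : ℝ × ℝ => evenVolume r k x.1 x.2 := by
  have := continuous_dividedPow
  unfold evenVolume
  fun_prop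

lemma continuous_oddVolume (r : ℝ) (k : ℕ) :
    Continuous fun x : ℝ × ℝ => oddVolume r k x.1 x.2 := by
  have := continuous_dividedPow
  unfold oddVolume
  fun_prop

/-- Differentiating lowers each divided power of `q` by one; the `j = 0` term of the subtracted sum
does not involve `q` and drops out, which shifts that sum to the even one. -/
lemma hasDerivAt_oddVolume (r : ℝ) (k : ℕ) (p q : ℝ) :
    HasDerivAt (fun q => oddVolume r k p q) (evenVolume r k p q) q := by
  have hfun : (fun q => oddVolume r k p q) = fun q =>
      ∑ j ∈ Finset.range (k + 1), dividedPow j p * dividedPow (2 * k - j + 1) q -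
      (∑ j ∈ Finset.range k,
        r ^ (2 * k - 1 - 2 * j) * (dividedPow (2 * k - j) p * dividedPow (j + 1) q) +
        r ^ (2 * k + 1) * dividedPow (2 * k + 1) p) := by
    funext q
    unfold oddVolume
    congr 1
    · refine Finset.sum_congr rfl fun j hj => ?_
      rw [Finset.mem_range] at hj
      rw [show 2 * k + 1 - j = 2 * k - j + 1 by lia]
    · rw [Finset.sum_range_succ']
      congr 1
      · refine Finset.sum_congr rfl fun j hj => ?_
        rw [show 2 * k + 1 - 2 * (j + 1) = 2 * k - 1 - 2 * j by lia,
          show 2 * k + 1 - (j + 1) = 2 * k - j by lia]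
      · simp [dividedPow_zero_left]
  rw [hfun]
  unfold evenVolume
  refine HasDerivAt.sub ?_ (HasDerivAt.add_const _ ?_)
  · exact HasDerivAt.fun_sum fun j _ => (hasDerivAt_dividedPow_succ _ q).const_mul _
  · exact HasDerivAt.fun_sum fun j _ =>
      ((hasDerivAt_dividedPow_succ _ q).const_mul _).const_mul _

lemma hasDerivAt_evenVolume_succ (r : ℝ) (k : ℕ) (p q : ℝ) :
    HasDerivAt (fun p => evenVolume r (k + 1) p q) (oddVolume r k p q) p := by
  have hfun : (fun p => evenVolume r (k + 1) p q) = fun p =>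
      (∑ j ∈ Finset.range (k + 1), dividedPow (j + 1) p * dividedPow (2 * k + 1 - j) q +
        dividedPow (2 * (k + 1)) q) -
      ∑ j ∈ Finset.range (k + 1),
        r ^ (2 * k + 1 - 2 * j) * (dividedPow (2 * k + 1 - j + 1) p * dividedPow j q) := by
    funext p
    unfold evenVolume
    congr 1
    · rw [Finset.sum_range_succ']
      congr 1
      · refine Finset.sum_congr rfl fun j hj => ?_
        rw [show 2 * (k + 1) - (j + 1) = 2 * k + 1 - j by lia]
      · simp [dividedPow_zero_left]
    · refine Finset.sum_congr rfl fun j hj => ?_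
      rw [Finset.mem_range] at hj
      rw [show 2 * (k + 1) - 1 - 2 * j = 2 * k + 1 - 2 * j by lia,
        show 2 * (k + 1) - j = 2 * k + 1 - j + 1 by lia]
  rw [hfun]
  unfold oddVolume
  refine HasDerivAt.sub (HasDerivAt.add_const _ ?_) ?_
  · exact HasDerivAt.fun_sum fun j _ => (hasDerivAt_dividedPow_succ _ p).mul_const _
  · exact HasDerivAt.fun_sum fun j _ =>
      ((hasDerivAt_dividedPow_succ _ p).mul_const _).const_mul _

/-- The two sums cancel term by term, since `r ^ (2k+1-j) = r ^ (2k+1-2j) * r ^ j` for `j ≤ k`. -/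
lemma oddVolume_barrier (r : ℝ) (k : ℕ) (p : ℝ) : oddVolume r k p (r * p) = 0 := by
  unfold oddVolume
  rw [sub_eq_zero]
  refine Finset.sum_congr rfl fun j hj => ?_
  rw [Finset.mem_range] at hj
  rw [dividedPow_mul, dividedPow_mul, show 2 * k + 1 - j = (2 * k + 1 - 2 * j) + j by lia, pow_add]
  ring

lemma evenVolume_zero_left (r : ℝ) (k : ℕ) (q : ℝ) :
    evenVolume r k 0 q = dividedPow (2 * k) q := by
  unfold evenVolume
  rw [Finset.sum_eq_zero (s := Finset.range k), Finset.sum_range_succ', Finset.sum_eq_zero]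
  · simp [dividedPow_zero_left]
  · intro j _
    rw [dividedPow_zero_right (by lia), zero_mul]
  · intro j hj
    rw [Finset.mem_range] at hj
    rw [dividedPow_zero_right (by lia), zero_mul, mul_zero]

lemma oddVolume_zero_left (r : ℝ) (k : ℕ) (q : ℝ) :
    oddVolume r k 0 q = dividedPow (2 * k + 1) q := by
  unfold oddVolume
  rw [Finset.sum_eq_zero (s := Finset.range (k + 1))
    (f := fun j => r ^ (2 * k + 1 - 2 * j) * (dividedPow (2 * k + 1 - j) 0 * dividedPow j q)),
    Finset.sum_range_succ', Finset.sum_eq_zero]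
  · simp [dividedPow_zero_left]
  · intro j _
    rw [dividedPow_zero_right (by lia), zero_mul]
  · intro j hj
    rw [Finset.mem_range] at hj
    rw [dividedPow_zero_right (by lia), zero_mul, mul_zero]

lemma integral_dividedPow_sub (n : ℕ) (s a b : ℝ) :
    ∫ u in a..b, dividedPow n (s - u) =
      dividedPow (n + 1) (s - a) - dividedPow (n + 1) (s - b) := by
  have hd : ∀ u, HasDerivAt (fun u => -dividedPow (n + 1) (s - u)) (dividedPow n (s - u)) u := by
    intro u
    have := ((hasDerivAt_dividedPow_succ n (s - u)).comp u ((hasDerivAt_id u).const_sub s)).neg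
    exact this.congr_deriv (by ring)
  have hc : Continuous fun u => dividedPow n (s - u) :=
    (continuous_dividedPow n).comp (by fun_prop)
  rw [intervalIntegral.integral_eq_sub_of_hasDerivAt (fun u _ => hd u)
    (hc.intervalIntegrable _ _)]
  ring

/-! ### Weights and their first-reversal integral equations -/

/-- The weight (in time units) of the paths with `2k` reversals in `[0, s]`, starting leftwards,
whose maximum is at most `b ≥ 0`. -/
noncomputable def leftWeight (c₁ c₂ : ℝ) (k : ℕ) (s b : ℝ) : ℝ :=
  if b ≤ c₁ * s then evenVolume (c₂ / c₁) k (c₁ * s - b) (c₂ * s + b) / (c₁ + c₂) ^ (2 * k)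
  else dividedPow (2 * k) s

/-- The weight of the paths with `2k + 1` reversals in `[0, s]`, starting rightwards,
whose maximum is at most `b ≥ 0`. -/
noncomputable def rightWeight (c₁ c₂ : ℝ) (k : ℕ) (s b : ℝ) : ℝ :=
  if b ≤ c₁ * s then
    oddVolume (c₂ / c₁) k (c₁ * s - b) (c₂ * s + b) / (c₁ + c₂) ^ (2 * k + 1)
  else dividedPow (2 * k + 1) s

/-- The two branches agree at `b = c₁ s`: there `p = 0` and `q = (c₁ + c₂) s`, so the scaling factor
cancels. -/
lemma leftWeight_of_ge {c₁ c₂ : ℝ} (hc₁ : 0 < c₁) (hc₂ : 0 < c₂) {k : ℕ} {s b : ℝ}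
    (h : c₁ * s ≤ b) :
    leftWeight c₁ c₂ k s b = dividedPow (2 * k) s := by
  unfold leftWeight
  split_ifs with h'
  · obtain rfl : b = c₁ * s := le_antisymm h' h
    have hc : c₁ + c₂ ≠ 0 := by positivity
    rw [sub_self, evenVolume_zero_left, show c₂ * s + c₁ * s = (c₁ + c₂) * s by ring,
      dividedPow_mul]
    field_simp
  · rfl

lemma rightWeight_of_ge {c₁ c₂ : ℝ} (hc₁ : 0 < c₁) (hc₂ : 0 < c₂) {k : ℕ} {s b : ℝ}
    (h : c₁ * s ≤ b) :
    rightWeight c₁ c₂ k s b = dividedPow (2 * k + 1) s := by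
  unfold rightWeight
  split_ifs with h'
  · obtain rfl : b = c₁ * s := le_antisymm h' h
    have hc : c₁ + c₂ ≠ 0 := by positivity
    rw [sub_self, oddVolume_zero_left, show c₂ * s + c₁ * s = (c₁ + c₂) * s by ring,
      dividedPow_mul]
    field_simp
  · rfl

/-- First-reversal decomposition for paths that start rightwards. -/
lemma integral_leftWeight {c₁ c₂ : ℝ} (hc₁ : 0 < c₁) (hc₂ : 0 < c₂) (k : ℕ) {s b : ℝ}
    (hs : 0 ≤ s) (hb : 0 ≤ b) :
    ∫ u in 0..s, (if c₁ * u ≤ b then leftWeight c₁ c₂ k (s - u) (b - c₁ * u) else 0) =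
      rightWeight c₁ c₂ k s b := by
  rcases le_total (c₁ * s) b with h | h
  · rw [rightWeight_of_ge hc₁ hc₂ h]
    trans ∫ u in 0..s, dividedPow (2 * k) (s - u)
    · refine intervalIntegral.integral_congr fun u hu => ?_
      rw [uIcc_of_le hs] at hu
      have h1 : c₁ * u ≤ c₁ * s := mul_le_mul_of_nonneg_left hu.2 hc₁.le
      rw [if_pos (h1.trans h), leftWeight_of_ge hc₁ hc₂ (by linarith)]
    · rw [integral_dividedPow_sub, sub_self, dividedPow_zero_right (by lia)]
      simp
  · have hc : c₁ + c₂ ≠ 0 := by positivity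
    -- The time at which the initial rightward leg hits the barrier; a longer first leg contributes
    -- nothing.
    set w := b / c₁ with hw
    have hbw : b = c₁ * w := by rw [hw]; field_simp
    have hw0 : 0 ≤ w := by positivity
    have hws : w ≤ s := by rw [hw, div_le_iff₀ hc₁]; linarith
    set g : ℝ → ℝ := fun u => evenVolume (c₂ / c₁) k (c₁ * s - b) (c₂ * s + b - (c₁ + c₂) * u) /
      (c₁ + c₂) ^ (2 * k)
    have hg : Continuous g :=
      ((continuous_evenVolume _ k).comp
        (g := fun x : ℝ × ℝ => evenVolume (c₂ / c₁) k x.1 x.2)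
        (f := fun u : ℝ => (c₁ * s - b, c₂ * s + b - (c₁ + c₂) * u)) (by fun_prop)).div_const _
    have e1 : ∀ u ∈ Ioc 0 w,
        (if c₁ * u ≤ b then leftWeight c₁ c₂ k (s - u) (b - c₁ * u) else 0) = g u := by
      intro u hu
      have h1 : c₁ * u ≤ c₁ * w := mul_le_mul_of_nonneg_left hu.2 hc₁.le
      rw [if_pos (by linarith), leftWeight, if_pos (by linarith)]
      simp only [g]
      congr 2 <;> ring
    have e2 : ∀ u ∈ Ioc w s,
        (if c₁ * u ≤ b then leftWeight c₁ c₂ k (s - u) (b - c₁ * u) else 0) = 0 := by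
      intro u hu
      have h1 : c₁ * w < c₁ * u := mul_lt_mul_of_pos_left hu.1 hc₁
      rw [if_neg (by linarith)]
    rw [intervalIntegral.integral_of_le hs, ← Ioc_union_Ioc_eq_Ioc hw0 hws,
      setIntegral_union (Ioc_disjoint_Ioc_of_le le_rfl) measurableSet_Ioc,
      setIntegral_congr_fun measurableSet_Ioc e1, setIntegral_congr_fun measurableSet_Ioc e2,
      ← intervalIntegral.integral_of_le hw0]
    · rw [integral_zero, add_zero]
      have hd : ∀ u, HasDerivAt (fun u => -(oddVolume (c₂ / c₁) k (c₁ * s - b)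
          (c₂ * s + b - (c₁ + c₂) * u) / (c₁ + c₂) ^ (2 * k + 1))) (g u) u := by
        intro u
        have := (((hasDerivAt_oddVolume (c₂ / c₁) k (c₁ * s - b)
          (c₂ * s + b - (c₁ + c₂) * u)).comp u
          (((hasDerivAt_id u).const_mul (c₁ + c₂)).const_sub (c₂ * s + b))).div_const
          ((c₁ + c₂) ^ (2 * k + 1))).neg
        refine this.congr_deriv ?_
        simp only [g, pow_succ]
        field_simp
      -- At `u = w` the remaining barrier is zero, so the endpoint lies on `q = r p` and its term
      -- vanishes.
      rw [intervalIntegral.integral_eq_sub_of_hasDerivAt (fun u _ => hd u)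
        (hg.intervalIntegrable _ _), rightWeight, if_pos h,
        show c₂ * s + b - (c₁ + c₂) * w = c₂ / c₁ * (c₁ * s - b) by rw [hw]; field_simp; ring,
        oddVolume_barrier]
      simp
    · exact (hg.integrableOn_Ioc).congr_fun (fun u hu => (e1 u hu).symm) measurableSet_Ioc
    · exact integrableOn_zero.congr_fun (fun u hu => (e2 u hu).symm) measurableSet_Ioc

/-- First-reversal decomposition for paths that start leftwards. -/
lemma integral_rightWeight {c₁ c₂ : ℝ} (hc₁ : 0 < c₁) (hc₂ : 0 < c₂) (k : ℕ) {s b : ℝ}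
    (hs : 0 ≤ s) (hb : 0 ≤ b) :
    ∫ u in 0..s, rightWeight c₁ c₂ k (s - u) (b + c₂ * u) = leftWeight c₁ c₂ (k + 1) s b := by
  rcases le_total (c₁ * s) b with h | h
  · rw [leftWeight_of_ge hc₁ hc₂ h]
    trans ∫ u in 0..s, dividedPow (2 * k + 1) (s - u)
    · refine intervalIntegral.integral_congr fun u hu => ?_
      rw [uIcc_of_le hs] at hu
      have h1 : 0 ≤ c₁ * u := mul_nonneg hc₁.le hu.1
      have h2 : 0 ≤ c₂ * u := mul_nonneg hc₂.le hu.1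
      rw [rightWeight_of_ge hc₁ hc₂ (by linarith)]
    · rw [integral_dividedPow_sub, sub_self, dividedPow_zero_right (by lia)]
      simp [mul_add]
  · have hc : 0 < c₁ + c₂ := by positivity
    -- After a leftward leg of this length the barrier can no longer be exceeded, and the integrand
    -- becomes the simplex volume.
    set w := (c₁ * s - b) / (c₁ + c₂) with hw
    have hbw : c₁ * s - b = (c₁ + c₂) * w := by rw [hw]; field_simp
    have hw0 : 0 ≤ w := div_nonneg (by linarith) hc.le
    have hws : w ≤ s := by
      rw [hw, div_le_iff₀ hc]
      have : 0 ≤ c₂ * s := by positivity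
      linarith
    set g : ℝ → ℝ := fun u => oddVolume (c₂ / c₁) k (c₁ * s - b - (c₁ + c₂) * u) (c₂ * s + b) /
      (c₁ + c₂) ^ (2 * k + 1)
    have hg : Continuous g :=
      ((continuous_oddVolume _ k).comp
        (g := fun x : ℝ × ℝ => oddVolume (c₂ / c₁) k x.1 x.2)
        (f := fun u : ℝ => (c₁ * s - b - (c₁ + c₂) * u, c₂ * s + b)) (by fun_prop)).div_const _
    have hg' : Continuous fun u => dividedPow (2 * k + 1) (s - u) :=
      (continuous_dividedPow _).comp (by fun_prop)
    have e1 : ∀ u ∈ Ioc 0 w, rightWeight c₁ c₂ k (s - u) (b + c₂ * u) = g u := by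
      intro u hu
      have h1 : (c₁ + c₂) * u ≤ (c₁ + c₂) * w := mul_le_mul_of_nonneg_left hu.2 hc.le
      rw [rightWeight, if_pos (by linarith)]
      simp only [g]
      congr 2 <;> ring
    have e2 : ∀ u ∈ Ioc w s,
        rightWeight c₁ c₂ k (s - u) (b + c₂ * u) = dividedPow (2 * k + 1) (s - u) := by
      intro u hu
      have h1 : (c₁ + c₂) * w ≤ (c₁ + c₂) * u := mul_le_mul_of_nonneg_left hu.1.le hc.le
      exact rightWeight_of_ge hc₁ hc₂ (by linarith)
    rw [intervalIntegral.integral_of_le hs, ← Ioc_union_Ioc_eq_Ioc hw0 hws,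
      setIntegral_union (Ioc_disjoint_Ioc_of_le le_rfl) measurableSet_Ioc,
      setIntegral_congr_fun measurableSet_Ioc e1, setIntegral_congr_fun measurableSet_Ioc e2,
      ← intervalIntegral.integral_of_le hw0, ← intervalIntegral.integral_of_le hws]
    · have hd : ∀ u, HasDerivAt (fun u => -(evenVolume (c₂ / c₁) (k + 1)
          (c₁ * s - b - (c₁ + c₂) * u) (c₂ * s + b) / (c₁ + c₂) ^ (2 * (k + 1)))) (g u) u := by
        intro u
        have := (((hasDerivAt_evenVolume_succ (c₂ / c₁) k (c₁ * s - b - (c₁ + c₂) * u)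
          (c₂ * s + b)).comp u
          (((hasDerivAt_id u).const_mul (c₁ + c₂)).const_sub (c₁ * s - b))).div_const
          ((c₁ + c₂) ^ (2 * (k + 1)))).neg
        refine this.congr_deriv ?_
        simp only [g, show 2 * (k + 1) = 2 * k + 1 + 1 by ring, pow_succ _ (2 * k + 1)]
        field_simp
      rw [integral_dividedPow_sub, intervalIntegral.integral_eq_sub_of_hasDerivAt
        (fun u _ => hd u) (hg.intervalIntegrable _ _), leftWeight, if_pos h, ← hbw, sub_self,
        sub_self, evenVolume_zero_left, dividedPow_zero_right (n := 2 * k + 1 + 1) (by lia),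
        show c₂ * s + b = (c₁ + c₂) * (s - w) by linear_combination -hbw, dividedPow_mul,
        show 2 * k + 1 + 1 = 2 * (k + 1) by ring]
      field_simp
      ring_nf
    · exact (hg.integrableOn_Ioc).congr_fun (fun u hu => (e1 u hu).symm) measurableSet_Ioc
    · exact (hg'.integrableOn_Ioc).congr_fun (fun u hu => (e2 u hu).symm) measurableSet_Ioc

/-! ### Confinement as an event of the waiting times -/

/-- For waiting times `x`, there are exactly `n` reversals in `[0, s]`, and the piecewise linear
path with successive velocities `v 0, v 1, …` is at most `b` at time `0` and at these reversals. -/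
def ConfinedPath (n : ℕ) (v : ℕ → ℝ) (s b : ℝ) (x : ℕ → ℝ) : Prop :=
  ∑ j ∈ Finset.range n, x j ≤ s ∧ s < ∑ j ∈ Finset.range (n + 1), x j ∧
    ∀ m ≤ n, ∑ j ∈ Finset.range m, v j * x j ≤ b

lemma confinedPath_succ (n : ℕ) (v : ℕ → ℝ) (s b : ℝ) (x : ℕ → ℝ) :
    ConfinedPath (n + 1) v s b x ↔ 0 ≤ b ∧
      ConfinedPath n (fun j => v (j + 1)) (s - x 0) (b - v 0 * x 0) (fun j => x (j + 1)) := by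
  unfold ConfinedPath
  rw [Finset.sum_range_succ' _ n, Finset.sum_range_succ' _ (n + 1), le_sub_iff_add_le,
    sub_lt_iff_lt_add]
  constructor
  · rintro ⟨h1, h2, h3⟩
    refine ⟨by simpa using h3 0 (by lia), h1, h2, fun m hm => ?_⟩
    have := h3 (m + 1) (by lia)
    rw [Finset.sum_range_succ'] at this
    linarith
  · rintro ⟨h0, h1, h2, h3⟩
    refine ⟨h1, h2, fun m hm => ?_⟩
    rcases m with _ | m
    · simpa using h0
    · have := h3 m (by lia)
      rw [Finset.sum_range_succ']
      linarith

lemma measurableSet_confinedPath_prod (n : ℕ) (v : ℕ → ℝ) (s b a : ℝ) :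
    MeasurableSet {z : ℝ × (ℕ → ℝ) | ConfinedPath n v (s - z.1) (b - a * z.1) z.2} := by
  simp only [ConfinedPath, ofPred_and, ofPred_forall]
  refine MeasurableSet.inter (measurableSet_le (by fun_prop) (by fun_prop))
    (MeasurableSet.inter (measurableSet_lt (by fun_prop) (by fun_prop)) ?_)
  exact MeasurableSet.iInter fun m => MeasurableSet.iInter fun _ =>
    measurableSet_le (by fun_prop) (by fun_prop)

lemma measurableSet_confinedPath (n : ℕ) (v : ℕ → ℝ) (s b : ℝ) :
    MeasurableSet {x | ConfinedPath n v s b x} := by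
  have h : Measurable fun x : ℕ → ℝ => ((0 : ℝ), x) := by fun_prop
  simpa using h (measurableSet_confinedPath_prod n v s b 0)

/-! ### Probabilities for exponential waiting times -/

section ExpSequence

variable {Ω : Type*} [MeasurableSpace Ω]

lemma iIndepFun.indepFun_zero_tail {μ : Measure Ω} {τ : ℕ → Ω → ℝ} (hm : ∀ n, Measurable (τ n))
    (h : iIndepFun τ μ) : IndepFun (τ 0) (fun ω n => τ (n + 1) ω) μ := by
  rw [IndepFun_iff_Indep]
  have h1 := indep_iSup_of_disjoint (fun i => (hm i).comap_le) ((iIndepFun_iff_iIndep _ _ _).1 h)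
    (S := {0}) (T := {0}ᶜ) disjoint_compl_right
  refine indep_of_indep_of_le_left (indep_of_indep_of_le_right h1 ?_) ?_
  · rw [MeasurableSpace.pi, MeasurableSpace.comap_iSup]
    refine iSup_le fun n => ?_
    rw [MeasurableSpace.comap_comp]
    exact le_iSup₂_of_le (n + 1) (by simp) le_rfl
  · exact le_iSup₂_of_le 0 (by simp) le_rfl

/-- `τ` is a sequence of i.i.d. exponential waiting times of parameter `lam`. -/
structure IsExpSequence (τ : ℕ → Ω → ℝ) (lam : ℝ) (μ : Measure Ω) : Prop where
  measurable : ∀ n, Measurable (τ n)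
  hasLaw : ∀ n, HasLaw (τ n) (expMeasure lam) μ
  indep : iIndepFun τ μ

lemma IsExpSequence.tail {μ : Measure Ω} {τ : ℕ → Ω → ℝ} {lam : ℝ} (h : IsExpSequence τ lam μ) :
    IsExpSequence (fun n => τ (n + 1)) lam μ :=
  ⟨fun _ => h.measurable _, fun _ => h.hasLaw _, h.indep.precomp (add_left_injective 1)⟩

lemma integral_expMeasure {lam : ℝ} (hlam : 0 < lam) (g : ℝ → ℝ) :
    ∫ u, g u ∂(expMeasure lam) = ∫ u in Ici 0, lam * Real.exp (-(lam * u)) * g u := by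
  have h0 : expMeasure lam = volume.withDensity (exponentialPDF lam) := rfl
  have hm : Measurable (exponentialPDF lam) := (measurable_exponentialPDFReal lam).ennreal_ofReal
  rw [h0, integral_withDensity_eq_integral_toReal_smul hm (by simp [exponentialPDF]),
    ← integral_indicator measurableSet_Ici]
  congr 1
  funext u
  by_cases hu : 0 ≤ u
  · rw [indicator_of_mem (mem_Ici.2 hu), exponentialPDF_eq, if_pos hu,
      ENNReal.toReal_ofReal (by positivity), smul_eq_mul]
  · rw [indicator_of_notMem (by simpa using hu), exponentialPDF_eq, if_neg hu]
    simp

lemma expMeasure_Iic_zero {lam : ℝ} : expMeasure lam (Iic 0) = 0 := by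
  have h0 : expMeasure lam = volume.withDensity (exponentialPDF lam) := rfl
  rw [h0, withDensity_apply _ measurableSet_Iic, setLIntegral_congr Iio_ae_eq_Iic.symm]
  rw [setLIntegral_congr_fun (g := fun _ => 0) measurableSet_Iio]
  · simp
  · intro u hu
    simp only
    rw [exponentialPDF_eq, if_neg (not_le.2 hu), ENNReal.ofReal_zero]

lemma IsExpSequence.ae_pos {μ : Measure Ω} {τ : ℕ → Ω → ℝ} {lam : ℝ}
    (h : IsExpSequence τ lam μ) : ∀ᵐ ω ∂μ, ∀ n, 0 < τ n ω := by
  rw [ae_all_iff]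
  intro n
  rw [ae_iff]
  simp only [not_lt]
  rw [(h.hasLaw n).measure_eq (p := fun x => x ≤ 0) measurableSet_Iic]
  exact expMeasure_Iic_zero

/-- Arrival times are nonnegative, and the path is at `0` at time `0`. This discards first legs that
outlast the horizon or cross the barrier. -/
lemma IsExpSequence.real_confinedPath_of_neg {μ : Measure Ω} {τ : ℕ → Ω → ℝ} {lam : ℝ}
    (h : IsExpSequence τ lam μ) (n : ℕ) (v : ℕ → ℝ) {s b : ℝ} (hsb : s < 0 ∨ b < 0) :
    μ.real {ω | ConfinedPath n v s b (fun j => τ j ω)} = 0 := by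
  rw [measureReal_def, measure_eq_zero_iff_ae_notMem.2, ENNReal.toReal_zero]
  filter_upwards [h.ae_pos] with ω hω
  rintro ⟨h1, -, h3⟩
  rcases hsb with hs | hb
  · have := Finset.sum_nonneg fun j (_ : j ∈ Finset.range n) => (hω j).le
    linarith
  · have := h3 0 (by lia)
    simp at this
    linarith

/-- First-reversal decomposition of the probability of `ConfinedPath`. -/
lemma IsExpSequence.real_confinedPath_succ {μ : Measure Ω} [IsProbabilityMeasure μ]
    {τ : ℕ → Ω → ℝ} {lam : ℝ} (hlam : 0 < lam)
    (h : IsExpSequence τ lam μ) (n : ℕ) (v : ℕ → ℝ) {s b : ℝ} (hs : 0 ≤ s) (hb : 0 ≤ b) :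
    μ.real {ω | ConfinedPath (n + 1) v s b (fun j => τ j ω)} =
      ∫ u in 0..s, lam * Real.exp (-(lam * u)) *
        μ.real {ω | ConfinedPath n (fun j => v (j + 1)) (s - u) (b - v 0 * u)
          (fun j => τ (j + 1) ω)} := by
  have hT : Measurable fun ω (j : ℕ) => τ (j + 1) ω :=
    measurable_pi_lambda _ fun j => h.measurable _
  set S : Set (ℝ × (ℕ → ℝ)) :=
    {z | ConfinedPath n (fun j => v (j + 1)) (s - z.1) (b - v 0 * z.1) z.2}
  have hS : MeasurableSet S := measurableSet_confinedPath_prod _ _ _ _ _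
  have hlaw := (indepFun_iff_map_prod_eq_prod_map_map (h.measurable 0).aemeasurable
    hT.aemeasurable).1 (iIndepFun.indepFun_zero_tail h.measurable h.indep)
  rw [(h.hasLaw 0).map_eq] at hlaw
  have : IsProbabilityMeasure (expMeasure lam) := isProbabilityMeasure_expMeasure hlam
  have : IsProbabilityMeasure (μ.map fun ω (j : ℕ) => τ (j + 1) ω) :=
    Measure.isProbabilityMeasure_map hT.aemeasurable
  have e1 : {ω | ConfinedPath (n + 1) v s b (fun j => τ j ω)} =
      (fun ω => (τ 0 ω, fun j => τ (j + 1) ω)) ⁻¹' S := by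
    ext ω
    simp [S, confinedPath_succ, hb]
  have e2 : ∀ u, (μ.map fun ω (j : ℕ) => τ (j + 1) ω) (Prod.mk u ⁻¹' S) =
      μ {ω | ConfinedPath n (fun j => v (j + 1)) (s - u) (b - v 0 * u)
          (fun j => τ (j + 1) ω)} := by
    intro u
    rw [Measure.map_apply hT (measurable_prodMk_left hS)]
    rfl
  rw [e1, measureReal_def, ← Measure.map_apply ((h.measurable 0).prodMk hT) hS, hlaw,
    Measure.prod_apply hS, ← integral_toReal (measurable_measure_prodMk_left hS).aemeasurable
      (.of_forall fun u => measure_lt_top _ _), integral_expMeasure hlam,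
    ← Icc_union_Ioi_eq_Ici hs, intervalIntegral.integral_of_le hs, ← integral_Icc_eq_integral_Ioc]
  simp_rw [e2, ← measureReal_def]
  -- A first waiting time beyond `s` leaves a negative horizon, so the integral stops at `s`.
  refine setIntegral_eq_of_subset_of_forall_sdiff_eq_zero
    (measurableSet_Icc.union measurableSet_Ioi) subset_union_left fun u hu => ?_
  have hu' : s < u := by
    rcases hu.1 with h1 | h1
    · exact absurd h1 hu.2
    · exact h1
  rw [h.tail.real_confinedPath_of_neg n _ (Or.inl (by linarith)), mul_zero]

lemma IsExpSequence.real_confinedPath_succ_eq {μ : Measure Ω} [IsProbabilityMeasure μ]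
    {τ : ℕ → Ω → ℝ} {lam : ℝ} (hlam : 0 < lam)
    (h : IsExpSequence τ lam μ) (n : ℕ) (v : ℕ → ℝ) {s b : ℝ} (hs : 0 ≤ s) (hb : 0 ≤ b)
    {F : ℝ → ℝ} (hF : ∀ u ∈ Icc 0 s,
      μ.real {ω | ConfinedPath n (fun j => v (j + 1)) (s - u) (b - v 0 * u)
        (fun j => τ (j + 1) ω)} = lam ^ n * Real.exp (-(lam * (s - u))) * F u) :
    μ.real {ω | ConfinedPath (n + 1) v s b (fun j => τ j ω)} =
      lam ^ (n + 1) * Real.exp (-(lam * s)) * ∫ u in 0..s, F u := by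
  rw [h.real_confinedPath_succ hlam n v hs hb, ← intervalIntegral.integral_const_mul]
  refine intervalIntegral.integral_congr fun u hu => ?_
  rw [uIcc_of_le hs] at hu
  rw [hF u hu, show -(lam * s) = -(lam * u) + -(lam * (s - u)) by ring, Real.exp_add]
  ring

lemma IsExpSequence.real_lt_zero {μ : Measure Ω} [IsProbabilityMeasure μ] {τ : ℕ → Ω → ℝ}
    {lam : ℝ} (hlam : 0 < lam) (h : IsExpSequence τ lam μ) {s : ℝ} (hs : 0 ≤ s) :
    μ.real {ω | s < τ 0 ω} = Real.exp (-(lam * s)) := by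
  have : IsProbabilityMeasure (expMeasure lam) := isProbabilityMeasure_expMeasure hlam
  rw [measureReal_def, (h.hasLaw 0).measure_eq (p := fun x => s < x) measurableSet_Ioi,
    ← measureReal_def, show {x : ℝ | s < x} = (Iic s)ᶜ by ext; simp,
    probReal_compl_eq_one_sub measurableSet_Iic, ← cdf_eq_real, cdf_expMeasure_eq hlam, if_pos hs]
  ring

/-- The velocities of a path that starts leftwards. -/
def leftVelocity (c₁ c₂ : ℝ) (j : ℕ) : ℝ := if Even j then -c₂ else c₁

/-- The velocities of a path that starts rightwards. -/
def rightVelocity (c₁ c₂ : ℝ) (j : ℕ) : ℝ := if Even j then c₁ else -c₂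

lemma leftVelocity_succ (c₁ c₂ : ℝ) (j : ℕ) :
    leftVelocity c₁ c₂ (j + 1) = rightVelocity c₁ c₂ j := by
  by_cases h : Even j <;> simp [leftVelocity, rightVelocity, h, Nat.even_add_one]

lemma rightVelocity_succ (c₁ c₂ : ℝ) (j : ℕ) :
    rightVelocity c₁ c₂ (j + 1) = leftVelocity c₁ c₂ j := by
  by_cases h : Even j <;> simp [leftVelocity, rightVelocity, h, Nat.even_add_one]

lemma leftWeight_zero {c₁ c₂ s b : ℝ} : leftWeight c₁ c₂ 0 s b = 1 := by
  simp [leftWeight, evenVolume, dividedPow_zero_left]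

/-- One half-step of the induction on `k`. The hypothesis covers every exponential sequence because
it is applied to the tail of `τ`. -/
lemma IsExpSequence.real_confinedPath_right {μ : Measure Ω} [IsProbabilityMeasure μ] {lam : ℝ}
    (hlam : 0 < lam) {c₁ c₂ : ℝ} (hc₁ : 0 < c₁) (hc₂ : 0 < c₂) (k : ℕ)
    (hleft : ∀ {τ : ℕ → Ω → ℝ}, IsExpSequence τ lam μ → ∀ {s b : ℝ}, 0 ≤ s → 0 ≤ b →
      μ.real {ω | ConfinedPath (2 * k) (leftVelocity c₁ c₂) s b (fun j => τ j ω)} =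
        lam ^ (2 * k) * Real.exp (-(lam * s)) * leftWeight c₁ c₂ k s b)
    {τ : ℕ → Ω → ℝ} (h : IsExpSequence τ lam μ) {s b : ℝ} (hs : 0 ≤ s) (hb : 0 ≤ b) :
    μ.real {ω | ConfinedPath (2 * k + 1) (rightVelocity c₁ c₂) s b (fun j => τ j ω)} =
      lam ^ (2 * k + 1) * Real.exp (-(lam * s)) * rightWeight c₁ c₂ k s b := by
  rw [← integral_leftWeight hc₁ hc₂ k hs hb]
  refine h.real_confinedPath_succ_eq hlam _ _ hs hb fun u hu => ?_
  simp_rw [rightVelocity_succ]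
  have h0 : rightVelocity c₁ c₂ 0 = c₁ := by simp [rightVelocity]
  rw [h0]
  split_ifs with hub
  · exact hleft h.tail (by linarith [hu.2]) (by linarith)
  · rw [mul_zero]
    exact h.tail.real_confinedPath_of_neg _ _ (Or.inr (by linarith))

lemma IsExpSequence.real_confinedPath_left {μ : Measure Ω} [IsProbabilityMeasure μ] {lam : ℝ}
    (hlam : 0 < lam) {c₁ c₂ : ℝ} (hc₁ : 0 < c₁) (hc₂ : 0 < c₂) (k : ℕ)
    {τ : ℕ → Ω → ℝ} (h : IsExpSequence τ lam μ) {s b : ℝ} (hs : 0 ≤ s) (hb : 0 ≤ b) :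
    μ.real {ω | ConfinedPath (2 * k) (leftVelocity c₁ c₂) s b (fun j => τ j ω)} =
      lam ^ (2 * k) * Real.exp (-(lam * s)) * leftWeight c₁ c₂ k s b := by
  induction k generalizing τ s b with
  | zero =>
    have e : {ω | ConfinedPath (2 * 0) (leftVelocity c₁ c₂) s b (fun j => τ j ω)} =
        {ω | s < τ 0 ω} := by
      ext ω
      simp [ConfinedPath, hs, hb]
    rw [e, h.real_lt_zero hlam hs, leftWeight_zero]
    simp
  | succ k ih =>
    rw [← integral_rightWeight hc₁ hc₂ k hs hb, show 2 * (k + 1) = 2 * k + 1 + 1 by ring]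
    refine h.real_confinedPath_succ_eq hlam _ _ hs hb fun u hu => ?_
    simp_rw [leftVelocity_succ]
    have h0 : leftVelocity c₁ c₂ 0 = -c₂ := by simp [leftVelocity]
    rw [h0, show b - -c₂ * u = b + c₂ * u by ring]
    have := mul_nonneg hc₂.le hu.1
    exact IsExpSequence.real_confinedPath_right hlam hc₁ hc₂ k
      (fun h' _ _ hs' hb' => ih h' hs' hb') h.tail (by linarith [hu.2]) (by linarith)

end ExpSequence

/-! ### Counting paths and the maximum of the trajectory -/

/-- The counting path `f` has its successive jumps, all of size one, at the positive waiting
times `x`. -/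
structure IsCountingPath (f : ℝ≥0 → ℕ) (x : ℕ → ℝ) : Prop where
  pos : ∀ n, 0 < x n
  le_iff : ∀ (m : ℕ) (s : ℝ≥0), m ≤ f s ↔ ∑ j ∈ Finset.range m, x j ≤ s

/-- Arrival times increase, so the indices of arrivals up to `s` form an initial segment of `ℕ`, and
its cardinality decides which arrivals have occurred. -/
lemma isCountingPath_of_encard {f : ℝ≥0 → ℕ} {x : ℕ → ℝ} (hx : ∀ n, 0 < x n)
    (hf : ∀ t : ℝ≥0, (f t : ℕ∞) = {n : ℕ | ∑ j ∈ Finset.range (n + 1), x j ≤ t}.encard) :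
    IsCountingPath f x := by
  have hmono : Monotone fun m => ∑ j ∈ Finset.range m, x j := by
    refine monotone_nat_of_le_succ fun n => ?_
    rw [Finset.sum_range_succ]
    linarith [hx n]
  have hcard : ∀ n : ℕ, (Iio n).encard = n := fun n => by
    rw [← Finset.coe_Iio, Set.encard_coe_eq_coe_finsetCard, Nat.card_Iio]
  refine ⟨hx, fun m s => ?_⟩
  rcases m with _ | m
  · simp
  constructor
  · intro hm
    by_contra hlt
    have hsub : {n : ℕ | ∑ j ∈ Finset.range (n + 1), x j ≤ s} ⊆ Iio m := by
      intro n hn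
      by_contra hnm
      exact hlt ((hmono (show m + 1 ≤ n + 1 by simpa using hnm)).trans hn)
    have := Set.encard_le_encard hsub
    rw [← hf, hcard, Nat.cast_le] at this
    lia
  · intro hm
    have hsub : Iio (m + 1) ⊆ {n : ℕ | ∑ j ∈ Finset.range (n + 1), x j ≤ s} := by
      intro n hn
      exact (hmono (show n + 1 ≤ m + 1 from hn)).trans hm
    have := Set.encard_le_encard hsub
    rwa [← hf, hcard, Nat.cast_le] at this

lemma IsCountingPath.monotone {f : ℝ≥0 → ℕ} {x : ℕ → ℝ} (h : IsCountingPath f x) :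
    Monotone f := by
  intro s t hst
  rw [h.le_iff]
  exact ((h.le_iff _ _).1 le_rfl).trans (by exact_mod_cast hst)

lemma intervalIntegrable_comp_counting {f : ℝ≥0 → ℕ} (hf : Monotone f) {g : ℕ → ℝ} {C : ℝ}
    (hg : ∀ n, |g n| ≤ C) (a b : ℝ) :
    IntervalIntegrable (fun u => g (f u.toNNReal)) volume a b := by
  have hm : Measurable fun u : ℝ => g (f u.toNNReal) :=
    (measurable_from_top (f := g)).comp (show Monotone fun u : ℝ => f u.toNNReal from
      fun _ _ huv => hf (Real.toNNReal_mono huv)).measurable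
  exact (intervalIntegrable_const (c := C)).mono_fun hm.aestronglyMeasurable
    (.of_forall fun u => by
      simpa using (hg _).trans (le_abs_self C))

/-- The primitive of a bounded measurable velocity is continuous, and `[0, t]` is compact. -/
lemma isGreatest_of_counting {f : ℝ≥0 → ℕ} (hf : Monotone f) {g : ℕ → ℝ} {C : ℝ}
    (hg : ∀ n, |g n| ≤ C) (t : ℝ≥0) :
    IsGreatest ((fun s : ℝ≥0 => ∫ u in (0 : ℝ)..s, g (f u.toNNReal)) '' Icc 0 t)
      (sSup ((fun s : ℝ≥0 => ∫ u in (0 : ℝ)..s, g (f u.toNNReal)) '' Icc 0 t)) := by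
  have hc : Continuous fun s : ℝ≥0 => ∫ u in (0 : ℝ)..s, g (f u.toNNReal) :=
    (intervalIntegral.continuous_primitive (intervalIntegrable_comp_counting hf hg) 0).comp
      NNReal.continuous_coe
  exact (isCompact_Icc.image hc).isGreatest_sSup ⟨_, mem_image_of_mem _ (left_mem_Icc.2 zero_le)⟩

lemma IsCountingPath.integral_between {f : ℝ≥0 → ℕ} {x : ℕ → ℝ} (h : IsCountingPath f x)
    (g : ℕ → ℝ) {m : ℕ} {a b : ℝ} (hab : a ≤ b) (ha : ∑ j ∈ Finset.range m, x j ≤ a)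
    (hb : b ≤ ∑ j ∈ Finset.range (m + 1), x j) :
    ∫ u in a..b, g (f u.toNNReal) = g m * (b - a) := by
  have h0 : 0 ≤ ∑ j ∈ Finset.range m, x j := Finset.sum_nonneg fun j _ => (h.pos j).le
  have e : ∀ u ∈ Ioo a b, g (f u.toNNReal) = g m := by
    intro u hu
    have hu0 : (u.toNNReal : ℝ) = u := Real.coe_toNNReal u (by linarith [hu.1])
    congr 1
    refine le_antisymm ?_ ?_
    · by_contra hlt
      have h1 := (h.le_iff (m + 1) u.toNNReal).1 (by lia)
      rw [hu0] at h1
      linarith [hu.2]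
    · rw [h.le_iff, hu0]
      linarith [hu.1]
  rw [intervalIntegral.integral_of_le hab, integral_Ioc_eq_integral_Ioo,
    setIntegral_congr_fun measurableSet_Ioo e, ← integral_Ioc_eq_integral_Ioo,
    ← intervalIntegral.integral_of_le hab, intervalIntegral.integral_const, smul_eq_mul, mul_comm]

lemma IsCountingPath.integral_arrival {f : ℝ≥0 → ℕ} {x : ℕ → ℝ} (h : IsCountingPath f x)
    {g : ℕ → ℝ} {C : ℝ} (hg : ∀ n, |g n| ≤ C) (m : ℕ) :
    ∫ u in (0 : ℝ)..(∑ j ∈ Finset.range m, x j), g (f u.toNNReal) =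
      ∑ j ∈ Finset.range m, g j * x j := by
  have hi := intervalIntegrable_comp_counting h.monotone hg
  induction m with
  | zero => simp
  | succ m ih =>
    have hle : ∑ j ∈ Finset.range m, x j ≤ ∑ j ∈ Finset.range (m + 1), x j := by
      rw [Finset.sum_range_succ]; linarith [h.pos m]
    rw [← intervalIntegral.integral_add_adjacent_intervals (hi _ (∑ j ∈ Finset.range m, x j))
      (hi _ _), ih, h.integral_between g hle le_rfl le_rfl, Finset.sum_range_succ _ m,
      Finset.sum_range_succ _ m, add_sub_cancel_left]

lemma IsCountingPath.eq_iff {f : ℝ≥0 → ℕ} {x : ℕ → ℝ} (h : IsCountingPath f x) (n : ℕ)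
    (t : ℝ≥0) : f t = n ↔
      ∑ j ∈ Finset.range n, x j ≤ t ∧ t < ∑ j ∈ Finset.range (n + 1), x j := by
  rw [← h.le_iff, ← not_le, ← h.le_iff]
  lia

lemma abs_leftVelocity_le (c₁ c₂ : ℝ) (n : ℕ) : |leftVelocity c₁ c₂ n| ≤ |c₁| + |c₂| := by
  unfold leftVelocity
  split_ifs
  · rw [abs_neg]; linarith [abs_nonneg c₁]
  · linarith [abs_nonneg c₂]

/-- A path that starts and ends leftwards stays below `b` iff it does so at its reversals. -/
lemma IsCountingPath.confinedPath_iff {f : ℝ≥0 → ℕ} {x : ℕ → ℝ} (h : IsCountingPath f x)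
    {c₁ c₂ : ℝ} (hc₁ : 0 < c₁) (hc₂ : 0 < c₂) (k : ℕ) (t : ℝ≥0) (b : ℝ) :
    ConfinedPath (2 * k) (leftVelocity c₁ c₂) t b x ↔ f t = 2 * k ∧
      ∀ s ∈ Icc 0 t, ∫ u in (0 : ℝ)..s, leftVelocity c₁ c₂ (f u.toNNReal) ≤ b := by
  have hg := abs_leftVelocity_le c₁ c₂
  have hi := intervalIntegrable_comp_counting h.monotone hg
  have harr : ∀ m, 0 ≤ ∑ j ∈ Finset.range m, x j := fun m =>
    Finset.sum_nonneg fun j _ => (h.pos j).le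
  rw [ConfinedPath, ← and_assoc, ← h.eq_iff]
  refine and_congr_right fun hft => ⟨fun hb s hs => ?_, fun hb m hm => ?_⟩
  · have hm : f s ≤ 2 * k := hft ▸ h.monotone hs.2
    obtain ⟨h1, h2⟩ := (h.eq_iff (f s) s).1 rfl
    -- Moving left, the path lies below its value at the last reversal (or at time `0`); moving
    -- right, below its value at the next one. The latter occurs by time `t` because an odd `f s ≤
    -- 2k` satisfies `f s + 1 ≤ 2k`.
    by_cases he : Even (f s)
    · rw [← intervalIntegral.integral_add_adjacent_intervals
        (hi 0 (∑ j ∈ Finset.range (f s), x j)) (hi _ s), h.integral_arrival hg,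
        h.integral_between _ h1 le_rfl h2.le, leftVelocity, if_pos he]
      have := mul_nonneg hc₂.le (sub_nonneg.2 h1)
      linarith [hb _ hm]
    · have hm' : f s + 1 ≤ 2 * k := by
        rw [Nat.not_even_iff_odd] at he
        obtain ⟨i, hi⟩ := he
        lia
      have e := intervalIntegral.integral_add_adjacent_intervals
        (hi 0 s) (hi s (∑ j ∈ Finset.range (f s + 1), x j))
      rw [h.integral_arrival hg, h.integral_between _ h2.le h1 le_rfl, leftVelocity,
        if_neg he] at e
      have := mul_nonneg hc₁.le (sub_nonneg.2 h2.le)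
      linarith [hb _ hm']
  · have h1 := (h.le_iff m t).1 (hft ▸ hm)
    rw [← h.integral_arrival hg]
    exact hb ⟨_, harr m⟩ ⟨zero_le, by exact_mod_cast h1⟩

lemma IsCountingPath.confinedPath_top_iff {f : ℝ≥0 → ℕ} {x : ℕ → ℝ} (h : IsCountingPath f x)
    {c₁ c₂ : ℝ} (hc₁ : 0 < c₁) (hc₂ : 0 < c₂) (n : ℕ) (t : ℝ≥0) :
    ConfinedPath n (leftVelocity c₁ c₂) t (c₁ * t) x ↔ f t = n := by
  rw [ConfinedPath, ← and_assoc, ← h.eq_iff, and_iff_left_iff_imp]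
  intro hft m hm
  have h1 := (h.le_iff m t).1 (hft ▸ hm)
  calc ∑ j ∈ Finset.range m, leftVelocity c₁ c₂ j * x j
      ≤ ∑ j ∈ Finset.range m, c₁ * x j := by
        refine Finset.sum_le_sum fun j _ => mul_le_mul_of_nonneg_right ?_ (h.pos j).le
        unfold leftVelocity
        split_ifs <;> linarith
    _ = c₁ * ∑ j ∈ Finset.range m, x j := by rw [Finset.mul_sum]
    _ ≤ c₁ * t := mul_le_mul_of_nonneg_left h1 hc₁.le

/-! ### Recovering the waiting times from the counting process -/

/-- The `m`-th jump time of a counting path, read off at rational times. -/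
noncomputable def jumpTime (m : ℕ) (f : ℝ≥0 → ℕ) : ENNReal :=
  ⨅ q : ℚ, if m ≤ f (Real.toNNReal q) then (Real.toNNReal q : ENNReal) else ⊤

lemma measurable_jumpTime (m : ℕ) : Measurable (jumpTime m) :=
  Measurable.iInf fun _ => Measurable.ite
    (measurableSet_le measurable_const (measurable_pi_apply _)) measurable_const measurable_const

lemma IsCountingPath.jumpTime_eq {f : ℝ≥0 → ℕ} {x : ℕ → ℝ} (h : IsCountingPath f x) (m : ℕ) :
    (jumpTime m f).toReal = ∑ j ∈ Finset.range m, x j := by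
  have harr : 0 ≤ ∑ j ∈ Finset.range m, x j := Finset.sum_nonneg fun j _ => (h.pos j).le
  rw [← ENNReal.toReal_ofReal harr]
  congr 1
  refine le_antisymm (le_of_forall_gt fun c hc => ?_) (le_iInf fun q => ?_)
  · obtain ⟨q, -, hq1, hq2⟩ := ENNReal.lt_iff_exists_rat_btwn.1 hc
    refine iInf_lt_iff.2 ⟨q, ?_⟩
    rwa [if_pos]
    rw [h.le_iff]
    rw [ENNReal.ofReal, ENNReal.coe_lt_coe, Real.toNNReal_lt_iff_lt_coe harr] at hq1
    exact hq1.le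
  · split_ifs with hq
    · rw [h.le_iff] at hq
      rw [ENNReal.ofReal, ENNReal.coe_le_coe]
      exact Real.toNNReal_le_iff_le_coe.2 hq
    · exact le_top

/-- Independence is given for `N` only. Almost surely the waiting times are increments of jump
times, hence a measurable function of the path of `N`. -/
lemma indepFun_waitingTimes {Ω : Type*} [MeasurableSpace Ω] {μ : Measure Ω} {V₀ : Ω → ℝ}
    {N : ℝ≥0 → Ω → ℕ} {τ : ℕ → Ω → ℝ} (hind : IndepFun V₀ (fun ω t => N t ω) μ)
    (hpath : ∀ᵐ ω ∂μ, IsCountingPath (fun t => N t ω) (fun j => τ j ω)) :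
    IndepFun V₀ (fun ω j => τ j ω) μ := by
  have hφ : Measurable fun (f : ℝ≥0 → ℕ) (j : ℕ) =>
      (jumpTime (j + 1) f).toReal - (jumpTime j f).toReal :=
    measurable_pi_lambda _ fun j => (measurable_jumpTime _).ennreal_toReal.sub
      (measurable_jumpTime _).ennreal_toReal
  refine (hind.comp measurable_id hφ).congr (.of_forall fun _ => rfl) ?_
  filter_upwards [hpath] with ω hω
  funext j
  simp only [Function.comp_apply]
  rw [hω.jumpTime_eq, hω.jumpTime_eq, Finset.sum_range_succ, add_sub_cancel_left]

/-! ### Binomial form and conclusion -/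

lemma dividedPow_mul_dividedPow {n j : ℕ} (hj : j ≤ n) (p q : ℝ) :
    dividedPow j p * dividedPow (n - j) q = n.choose j * (p ^ j * q ^ (n - j)) / n.factorial := by
  rw [Nat.cast_choose ℝ hj]
  unfold dividedPow
  have : (n.factorial : ℝ) ≠ 0 := by positivity
  field_simp

lemma leftWeight_div {c₁ c₂ : ℝ} (hc₁ : 0 < c₁) (hc₂ : 0 < c₂) (k : ℕ) {t b : ℝ} (ht : 0 < t)
    (hb : b ≤ c₁ * t) :
    leftWeight c₁ c₂ k t b / dividedPow (2 * k) t =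
      ∑ j ∈ Finset.range (k + 1), ((2 * k).choose j : ℝ) *
          ((c₁ * t - b) ^ j * (c₂ * t + b) ^ (2 * k - j) / ((c₁ + c₂) * t) ^ (2 * k)) -
      ∑ j ∈ Finset.range k, ((2 * k).choose j : ℝ) * (c₂ / c₁) ^ (2 * k - 1 - 2 * j) *
          ((c₁ * t - b) ^ (2 * k - j) * (c₂ * t + b) ^ j / ((c₁ + c₂) * t) ^ (2 * k)) := by
  have hc : c₁ + c₂ ≠ 0 := by positivity
  have hf : ((2 * k).factorial : ℝ) ≠ 0 := by positivity
  rw [leftWeight, if_pos hb, evenVolume, sub_div, sub_div, Finset.sum_div, Finset.sum_div,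
    Finset.sum_div, Finset.sum_div]
  congr 1 <;> refine Finset.sum_congr rfl fun j hj => ?_ <;> rw [Finset.mem_range] at hj
  · rw [dividedPow_mul_dividedPow (by lia), dividedPow, mul_pow]
    field_simp
  · rw [mul_comm (dividedPow (2 * k - j) _), dividedPow_mul_dividedPow (by lia), dividedPow,
      mul_pow]
    generalize (c₂ / c₁) ^ (2 * k - 1 - 2 * j) = r
    field_simp

theorem theorem3p1 {Ω : Type*} [MeasurableSpace Ω] (μ : Measure Ω) [IsProbabilityMeasure μ]
    (c₁ c₂ lam : ℝ) (hc₁ : 0 < c₁) (hc₂ : 0 < c₂) (hlam : 0 < lam)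
    (V₀ : Ω → ℝ) (N : ℝ≥0 → Ω → ℕ) (h : IsTelegraphData c₁ c₂ lam V₀ N μ)
    (t : ℝ≥0) (ht : 0 < t) (k : ℕ) (β : ℝ) (hβ : β ∈ Icc (0 : ℝ) (c₁ * t)) :
    μ {ω | V₀ ω = -c₂ ∧ N t ω = 2 * k} ≠ 0 ∧
    (∀ᵐ ω ∂μ, IsGreatest ((fun s => telegraphProcess c₁ c₂ V₀ N s ω) '' Icc 0 t)
      (runningMax (telegraphProcess c₁ c₂ V₀ N) t ω)) ∧
    (ProbabilityTheory.cond μ {ω | V₀ ω = -c₂ ∧ N t ω = 2 * k}).real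
        {ω | runningMax (telegraphProcess c₁ c₂ V₀ N) t ω ≤ β} =
      ∑ j ∈ Finset.range (k + 1), ((2 * k).choose j : ℝ) *
          ((c₁ * t - β) ^ j * (c₂ * t + β) ^ (2 * k - j) / ((c₁ + c₂) * t) ^ (2 * k)) -
      ∑ j ∈ Finset.range k, ((2 * k).choose j : ℝ) * (c₂ / c₁) ^ (2 * k - 1 - 2 * j) *
          ((c₁ * t - β) ^ (2 * k - j) * (c₂ * t + β) ^ j / ((c₁ + c₂) * t) ^ (2 * k)) := by
  obtain ⟨τ, hτm, hτl, hτi, hτN⟩ := h.poisson.exists_waitingTimes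
  have hτ : IsExpSequence τ lam μ := ⟨hτm, hτl, hτi⟩
  have hpath : ∀ᵐ ω ∂μ, IsCountingPath (fun t => N t ω) (fun j => τ j ω) := by
    filter_upwards [hτ.ae_pos, hτN] with ω h1 h2
    exact isCountingPath_of_encard h1 h2
  have ht' : (0 : ℝ) < t := ht
  have hmax : ∀ᵐ ω ∂μ, IsGreatest ((fun s => telegraphProcess c₁ c₂ V₀ N s ω) '' Icc 0 t)
      (runningMax (telegraphProcess c₁ c₂ V₀ N) t ω) := by
    filter_upwards [hpath] with ω hω
    refine isGreatest_of_counting hω.monotone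
      (g := fun n => if Even n then V₀ ω else c₁ - c₂ - V₀ ω)
      (C := |V₀ ω| + |c₁ - c₂ - V₀ ω|) (fun n => ?_) t
    split_ifs
    · linarith [abs_nonneg (c₁ - c₂ - V₀ ω)]
    · linarith [abs_nonneg (V₀ ω)]
  set E : ℝ → Set Ω := fun b =>
    {ω | V₀ ω = -c₂} ∩ {ω | ConfinedPath (2 * k) (leftVelocity c₁ c₂) t b (fun j => τ j ω)}
  have hE : ∀ b, 0 ≤ b → μ.real (E b) =
      1 / 2 * (lam ^ (2 * k) * Real.exp (-(lam * t)) * leftWeight c₁ c₂ k t b) := by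
    intro b hb
    rw [← hτ.real_confinedPath_left hlam hc₁ hc₂ k ht'.le hb]
    have := (indepFun_waitingTimes h.indep hpath).measure_inter_preimage_eq_mul {-c₂}
      {x | ConfinedPath (2 * k) (leftVelocity c₁ c₂) t b x} (measurableSet_singleton _)
      (measurableSet_confinedPath _ _ _ _)
    have e : μ (E b) = 1 / 2 * μ {ω | ConfinedPath (2 * k) (leftVelocity c₁ c₂) t b
        (fun j => τ j ω)} := by
      rw [← h.init_left]
      exact this
    rw [measureReal_def, e, ENNReal.toReal_mul, measureReal_def]
    simp
  have hD : μ.real {ω | V₀ ω = -c₂ ∧ N t ω = 2 * k} =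
      1 / 2 * (lam ^ (2 * k) * Real.exp (-(lam * t)) * dividedPow (2 * k) t) := by
    -- No path exceeds the barrier `c₁ t`, so `hE` at that level gives the probability of the
    -- conditioning event.
    rw [← leftWeight_of_ge hc₁ hc₂ (le_refl (c₁ * (t : ℝ))), ← hE _ (by positivity)]
    refine measureReal_congr ?_
    filter_upwards [hpath] with ω hω
    exact propext (and_congr_right fun _ => (hω.confinedPath_top_iff hc₁ hc₂ _ t).symm)
  have hDpos : 0 < dividedPow (2 * k) (t : ℝ) := by unfold dividedPow; positivity
  have hDmeas : MeasurableSet {ω | V₀ ω = -c₂ ∧ N t ω = 2 * k} :=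
    (h.measurable_init (measurableSet_singleton _)).inter
      (h.poisson.measurable t (measurableSet_singleton _))
  have hDE : μ.real ({ω | V₀ ω = -c₂ ∧ N t ω = 2 * k} ∩
      {ω | runningMax (telegraphProcess c₁ c₂ V₀ N) t ω ≤ β}) = μ.real (E β) := by
    refine measureReal_congr ?_
    filter_upwards [hpath, hmax] with ω hω hmω
    refine propext ?_
    change (V₀ ω = -c₂ ∧ N t ω = 2 * k) ∧ _ ≤ β ↔ V₀ ω = -c₂ ∧ _
    rw [and_assoc]
    refine and_congr_right fun hV => ?_
    refine Iff.trans ?_ (hω.confinedPath_iff hc₁ hc₂ k t β).symm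
    refine and_congr_right fun _ => ?_
    -- Since the maximum is attained, the `sSup` is a true least upper bound, and the bound `β` can
    -- be tested at each time.
    rw [isLUB_le_iff hmω.isLUB, mem_upperBounds, forall_mem_image]
    refine forall₂_congr fun s _ => ?_
    have hvel : ∀ u, telegraphVelocity c₁ c₂ V₀ N u ω = leftVelocity c₁ c₂ (N u ω) := by
      intro u
      simp [telegraphVelocity, leftVelocity, hV]
    simp only [telegraphProcess, hvel]
  refine ⟨fun h0 => ?_, hmax, ?_⟩
  · rw [measureReal_def, h0] at hD
    have : 0 < lam ^ (2 * k) * Real.exp (-(lam * t)) * dividedPow (2 * k) (t : ℝ) := by positivity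
    rw [ENNReal.toReal_zero] at hD
    linarith
  · rw [measureReal_def, cond_apply hDmeas, ENNReal.toReal_mul, ENNReal.toReal_inv,
      ← measureReal_def, ← measureReal_def, hDE, hD, hE _ hβ.1, ← leftWeight_div hc₁ hc₂ k ht' hβ.2]
    field_simp
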